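/- **Definitions.** For an integer $n\ge 0$ let $E(K_n)$ be the edge set of the complete graph on $n$ vertices. For a mapping $f:E(K_n)\to E(K_n)$, a subgraph $S$ of $K_n$ is called *$f$-fixed* if $f(e)=e$ for all $e\in E(S)$, and *$f$-free* if $f(e)\notin E(S)$ for all $e\in E(S)$. For finite graphs $G,H$ let $m(G,H)$ be the least integer $n$ such that for every $N\ge n$, every mapping $f:E(K_N)\to E(K_N)$ admits an $f$-fixed copy of $G$ or an $f$-free copy of $H$ ($m(G,H)=\infty$ if there is no such $n$). A tree $T$ on $k$ vertices is an *Erdős–Sós tree* if $\mathrm{ex}(n,T)\le \frac{k-2}{2}\,n$ for all $n$, where $\mathrm{ex}(n,T)$ is the maximum number of edges of an $n$-vertex graph that contains no copy of $T$. $P_4$ denotes the path on $4$ vertices. **Theorem 1.1.** 1. For all integers $r\ge 1$ and $k\ge 2$ and every tree $T$ on $k$ vertices, $(r-1)(k-1)+1\le m(T,K_r)$. 2. a. For every integer $r\ge 2$ there is a constant $c_r$, depending only on $r$, such that $m(T,K_r)\le (r-1)(k-1)+c_r$ for every $k\ge 2$ and every Erdős–Sós tree $T$ on $k$ vertices. Moreover,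 for every $k\ge 2$ and every Erdős–Sós tree $T$ on $k$ vertices: b. $m(T,K_3)\le 2k+2$, and if $T\notin\{K_2,K_{1,3},P_4\}$ (up to isomorphism), then $m(T,K_3)\le 2k+1$; c. if $T\in\{K_2,K_{1,3},P_4\}$ (up to isomorphism), then $m(T,K_3)=2k+2$; d. $3k-2\le m(T,K_4)\le 3k+33$. -/

import Mathlib

/-- An edge mapping `f : E(K_n) → E(K_n)`. -/
abbrev EdgeMap (n : ℕ) : Type :=
  (⊤ : SimpleGraph (Fin n)).edgeSet → (⊤ : SimpleGraph (Fin n)).edgeSet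

/-- The subgraph `S` of `K_n` is `f`-fixed: `f e = e` for all `e ∈ E(S)`. -/
def EdgeMap.IsFixed {n : ℕ} (f : EdgeMap n) (S : (⊤ : SimpleGraph (Fin n)).Subgraph) : Prop :=
  ∀ e : (⊤ : SimpleGraph (Fin n)).edgeSet, (e : Sym2 (Fin n)) ∈ S.edgeSet → f e = e

/-- The subgraph `S` of `K_n` is `f`-free: `f e ∉ E(S)` for all `e ∈ E(S)`. -/
def EdgeMap.IsFree {n : ℕ} (f : EdgeMap n) (S : (⊤ : SimpleGraph (Fin n)).Subgraph) : Prop :=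
  ∀ e : (⊤ : SimpleGraph (Fin n)).edgeSet,
    (e : Sym2 (Fin n)) ∈ S.edgeSet → (f e : Sym2 (Fin n)) ∉ S.edgeSet

/-- The subgraph `S` of `K_n` is a copy of the graph `G`. -/
def IsCopyOf {V : Type*} {n : ℕ} (S : (⊤ : SimpleGraph (Fin n)).Subgraph)
    (G : SimpleGraph V) : Prop :=
  Nonempty (G ≃g S.coe)

/-- Every `f : E(K_n) → E(K_n)` has an `f`-fixed copy of `G` or an `f`-free copy of `H`. -/
def FixedOrFree {V W : Type*} (n : ℕ) (G : SimpleGraph V) (H : SimpleGraph W) : Prop :=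
  ∀ f : EdgeMap n,
    (∃ S : (⊤ : SimpleGraph (Fin n)).Subgraph, IsCopyOf S G ∧ f.IsFixed S) ∨
    (∃ S : (⊤ : SimpleGraph (Fin n)).Subgraph, IsCopyOf S H ∧ f.IsFree S)

/-- `m(G, H)`: the least `n` such that, for all `N ≥ n`, every `f : E(K_N) → E(K_N)` has an
`f`-fixed copy of `G` or an `f`-free copy of `H` (and `⊤` if there is no such `n`).

For `3 ≤ n`, `FixedOrFree n G H` implies `FixedOrFree (n + 1) G H`, so that "for all `N ≥ n`"
only excludes the degenerate value `n = 2`: as `K_2` has a single edge, the only edge mapping of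
`K_2` is the identity, and `FixedOrFree 2 K_2 H` holds for every graph `H`. -/
noncomputable def mNumber {V W : Type*} (G : SimpleGraph V) (H : SimpleGraph W) : ℕ∞ :=
  ⨅ (n : ℕ) (_ : ∀ N : ℕ, n ≤ N → FixedOrFree N G H), (n : ℕ∞)

/-- `T` is an Erdős–Sós tree on `k` vertices: a tree with `ex(n, T) ≤ (k - 2) / 2 * n`
for all `n`. -/
def IsErdosSosTree {k : ℕ} (T : SimpleGraph (Fin k)) : Prop :=
  T.IsTree ∧ ∀ n : ℕ, (SimpleGraph.extremalNumber n T : ℝ) ≤ ((k : ℝ) - 2) / 2 * (n : ℝ)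

/-- `T` is (isomorphic to) one of `K_2`, `K_{1,3}`, `P_4` (the path on four vertices). -/
def IsExceptionalTree {k : ℕ} (T : SimpleGraph (Fin k)) : Prop :=
  Nonempty (T ≃g SimpleGraph.completeGraph (Fin 2)) ∨
  Nonempty (T ≃g completeBipartiteGraph (Fin 1) (Fin 3)) ∨
  Nonempty (T ≃g SimpleGraph.pathGraph 4)

/-!
For an edge mapping `f` of `K_n`, call an edge moved if `f e ≠ e`. If no copy of the Erdős–Sós tree
`T` is fixed, then the fixed edges form a `T`-free graph, so that the graph of the moved edges has
average degree at least `n - (k - 1)`. By the Moon–Moser inequality (`SimpleGraph.moonMoser`) its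
numbers `N s` of `s`-cliques then satisfy `(s + 1) * N (s + 1) ≥ (n - s * (k - 1)) * N s`.

On the other hand, suppose that no copy of `K_r` is free. Then each `r`-clique of moved edges
contains a moved edge `e` together with `f e`. These span at least three vertices, so each moved
edge accounts for at most `n ^ (r - 3)` cliques, and `N r ≤ N 2 * n ^ (r - 3)`
(`EdgeMap.card_cliqueFinset_le_of_not_isFree`). For `n = (r - 1) * (k - 1) + c` with `c` large in
terms of `r` the two bounds contradict each other; for `r = 4` the choice `c = 36` is enough, and
for `r = 3` the choice `c = 4`, that is `n = 2 * k + 2`.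

For `r = 3` and `n = 2 * k + 1` the two bounds can only hold with equality. In the Moon–Moser
inequality this forces the fixed edges to form disjoint copies of `K_{k-1}`, so that `k - 1` divides
`2 * k + 1`, hence divides `3`, and `T` has two or four vertices. Conversely, in these two cases the
triangles of moved edges can be assigned to their edges so that each edge gets one triangle
(`not_fixedOrFree_completeGraph_three`), and mapping each edge to another edge of its triangle
leaves no free triangle.

The general lower bound comes from fixing exactly the edges inside `r - 1` disjoint copies of
`K_{k-1}`: a copy of `T` does not fit into one of them, and two vertices of each `K_r` lie in the
same one.
-/

/-! ### The Moon–Moser inequality -/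

namespace SimpleGraph

variable {V : Type*} [Fintype V] [DecidableEq V] (G : SimpleGraph V) [DecidableRel G.Adj]

/-- The vertices adjacent to every element of `C`, so that a clique `C` extends to a clique one
larger exactly by the elements of `G.extensions C`. -/
def extensions (C : Finset V) : Finset V := {v | ∀ c ∈ C, G.Adj c v}

variable {G}

lemma mem_extensions {C : Finset V} {v : V} : v ∈ G.extensions C ↔ ∀ c ∈ C, G.Adj c v := by
  simp [extensions]

lemma notMem_of_mem_extensions {C : Finset V} {v : V} (h : v ∈ G.extensions C) : v ∉ C :=
  fun hv => G.loopless.irrefl v (mem_extensions.1 h v hv)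

variable (G)

/-- Double counting of the pairs of an `s`-clique inside an `(s + 1)`-clique. -/
lemma sum_cliqueFinset_extensions (s : ℕ) (w : Finset V → ℕ) :
    ∑ C ∈ G.cliqueFinset s, ∑ _v ∈ G.extensions C, w C =
      ∑ A ∈ G.cliqueFinset (s + 1), ∑ u ∈ A, w (A.erase u) := by
  rw [Finset.sum_sigma', Finset.sum_sigma']
  refine Finset.sum_bij' (fun p _ => ⟨insert p.2 p.1, p.2⟩) (fun p _ => ⟨p.1.erase p.2, p.2⟩)
    ?_ ?_ ?_ ?_ ?_
  · rintro ⟨C, v⟩ h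
    simp only [Finset.mem_sigma, mem_cliqueFinset_iff] at h ⊢
    exact ⟨h.1.insert fun b hb => (mem_extensions.1 h.2 b hb).symm, Finset.mem_insert_self _ _⟩
  · rintro ⟨A, u⟩ h
    simp only [Finset.mem_sigma, mem_cliqueFinset_iff] at h ⊢
    refine ⟨⟨h.1.isClique.subset (by simp), by simp [Finset.card_erase_of_mem h.2, h.1.card_eq]⟩,
      mem_extensions.2 fun c hc => ?_⟩
    rw [Finset.mem_erase] at hc
    exact h.1.isClique hc.2 h.2 hc.1
  · rintro ⟨C, v⟩ h
    simp only [Finset.mem_sigma] at h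
    simp [Finset.erase_insert (notMem_of_mem_extensions h.2)]
  · rintro ⟨A, u⟩ h
    simp only [Finset.mem_sigma] at h
    simp [Finset.insert_erase h.2]
  · rintro ⟨C, v⟩ h
    simp only [Finset.mem_sigma] at h
    simp [Finset.erase_insert (notMem_of_mem_extensions h.2)]

lemma sum_card_extensions (s : ℕ) :
    ∑ C ∈ G.cliqueFinset s, (G.extensions C).card = (s + 1) * (G.cliqueFinset (s + 1)).card := by
  have h := G.sum_cliqueFinset_extensions s fun _ => 1
  simp only [Finset.sum_const, smul_eq_mul, mul_one] at h
  rw [h, Finset.sum_congr rfl fun A hA => (mem_cliqueFinset_iff.1 hA).card_eq, Finset.sum_const,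
    smul_eq_mul, mul_comm]

lemma sum_sq_card_extensions (s : ℕ) :
    ∑ C ∈ G.cliqueFinset s, (G.extensions C).card ^ 2 =
      ∑ A ∈ G.cliqueFinset (s + 1), ∑ v, (A.filter fun u => v ∈ G.extensions (A.erase u)).card := by
  have h := G.sum_cliqueFinset_extensions s fun C => (G.extensions C).card
  simp only [Finset.sum_const, smul_eq_mul] at h
  simp_rw [sq, h]
  refine Finset.sum_congr rfl fun A _ => ?_
  simp_rw [Finset.card_eq_sum_ones, Finset.sum_filter]
  rw [Finset.sum_comm]
  exact Finset.sum_congr rfl fun u _ => by rw [← Finset.sum_filter]; simp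

/-- Exchanging one vertex of a clique `A` for `v`: if `v` does not extend `A`, then some vertex of
`A` is not adjacent to `v`, and it is the only one that can be removed. -/
lemma card_exchange_le {s : ℕ} {A : Finset V} (hA : A.card = s + 1) (v : V) :
    (A.filter fun u => v ∈ G.extensions (A.erase u)).card ≤
      1 + s * if v ∈ G.extensions A then 1 else 0 := by
  split_ifs with hv
  · exact (Finset.card_filter_le _ _).trans (by omega)
  · rw [mem_extensions] at hv
    push Not at hv
    obtain ⟨c, hc, hcv⟩ := hv
    refine (Finset.card_le_card (t := {c}) fun u hu => ?_).trans (by simp)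
    rw [Finset.mem_filter, mem_extensions] at hu
    by_contra hne
    rw [Finset.mem_singleton] at hne
    exact hcv (hu.2 c (Finset.mem_erase.2 ⟨fun h => hne h.symm, hc⟩))

lemma sum_exchange_bound (s : ℕ) :
    ∑ A ∈ G.cliqueFinset (s + 1), ∑ v, (1 + s * if v ∈ G.extensions A then 1 else 0) =
      Fintype.card V * (G.cliqueFinset (s + 1)).card +
        s * ((s + 2) * (G.cliqueFinset (s + 2)).card) := by
  rw [← G.sum_card_extensions (s + 1), Finset.mul_sum]
  simp only [Finset.sum_add_distrib, ← Finset.mul_sum]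
  simp [mul_comm]

lemma sum_sq_card_extensions_le (s : ℕ) :
    ∑ C ∈ G.cliqueFinset s, (G.extensions C).card ^ 2 ≤
      Fintype.card V * (G.cliqueFinset (s + 1)).card +
        s * ((s + 2) * (G.cliqueFinset (s + 2)).card) := by
  rw [sum_sq_card_extensions, ← sum_exchange_bound]
  exact Finset.sum_le_sum fun A hA => Finset.sum_le_sum fun v _ =>
    G.card_exchange_le (mem_cliqueFinset_iff.1 hA).card_eq v

/-- The tangent-line form of the Cauchy–Schwarz inequality, as an identity. -/
lemma sum_sq_eq_add (s : ℕ) (x : ℤ) :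
    ∑ C ∈ G.cliqueFinset s, ((G.extensions C).card : ℤ) ^ 2 =
      ∑ C ∈ G.cliqueFinset s, ((G.extensions C).card - x) ^ 2 +
        x * ((s + 1) * (G.cliqueFinset (s + 1)).card - x * (G.cliqueFinset s).card) +
        x * ((s + 1) * (G.cliqueFinset (s + 1)).card) := by
  have h : (∑ C ∈ G.cliqueFinset s, ((G.extensions C).card : ℤ)) =
      (s + 1) * (G.cliqueFinset (s + 1)).card := by exact_mod_cast G.sum_card_extensions s
  rw [← h]
  simp only [sub_sq, Finset.sum_add_distrib, Finset.sum_sub_distrib, Finset.sum_const, nsmul_eq_mul,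
    ← Finset.sum_mul, ← Finset.mul_sum]
  ring

/-- One step of the Moon–Moser inequality: if `s`-cliques have on average at least
`n - s * q` extensions, then `(s + 1)`-cliques have on average at least `n - (s + 1) * q`. -/
lemma moonMoser_step {s : ℕ} (hs : 1 ≤ s) {q : ℤ} (hq : 0 ≤ Fintype.card V - s * q)
    (h : (Fintype.card V - s * q) * (G.cliqueFinset s).card ≤
      (s + 1) * (G.cliqueFinset (s + 1)).card) :
    (Fintype.card V - (s + 1) * q) * (G.cliqueFinset (s + 1)).card ≤
      (s + 2) * (G.cliqueFinset (s + 2)).card := by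
  have h1 : ∑ C ∈ G.cliqueFinset s, ((G.extensions C).card : ℤ) ^ 2 ≤
      Fintype.card V * (G.cliqueFinset (s + 1)).card +
        s * ((s + 2) * (G.cliqueFinset (s + 2)).card) := by
    exact_mod_cast G.sum_sq_card_extensions_le s
  rw [G.sum_sq_eq_add s (Fintype.card V - s * q)] at h1
  have h2 : (0 : ℤ) ≤ ∑ C ∈ G.cliqueFinset s,
      (((G.extensions C).card : ℤ) - (Fintype.card V - s * q)) ^ 2 :=
    Finset.sum_nonneg fun _ _ => sq_nonneg _
  have h3 := mul_nonneg hq (sub_nonneg.2 h)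
  have hs' : (0 : ℤ) < s := by exact_mod_cast hs
  refine le_of_mul_le_mul_left ?_ hs'
  linarith

/-- The Moon–Moser inequality: if `G` has average degree at least `n - q`, then for every `s` with
`s * q ≤ n` an `s`-clique has on average at least `n - s * q` extensions. -/
lemma moonMoser {q : ℤ}
    (h : (Fintype.card V - q) * (G.cliqueFinset 1).card ≤ 2 * (G.cliqueFinset 2).card) (hq : 0 ≤ q)
    {s : ℕ} (hs : 1 ≤ s) (hsq : s * q ≤ Fintype.card V) :
    (Fintype.card V - s * q) * (G.cliqueFinset s).card ≤
      (s + 1) * (G.cliqueFinset (s + 1)).card := by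
  induction s, hs using Nat.le_induction with
  | base => simpa using h
  | succ s hs ih =>
    push_cast at hsq ⊢
    have hsq' : s * q ≤ Fintype.card V := by linarith
    have := G.moonMoser_step hs (sub_nonneg.2 hsq') (ih hsq')
    rw [show ((s : ℤ) + 1 + 1) = s + 2 by ring]
    exact this

/-- Equality in the Moon–Moser inequality for triangles: all vertices have the same degree, and
every vertex is adjacent to an end of each edge. -/
lemma moonMoser_triangle_eq {q : ℤ} (hq : 0 < Fintype.card V - q)
    (h : (Fintype.card V - q) * (G.cliqueFinset 1).card ≤ 2 * (G.cliqueFinset 2).card)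
    (h3 : 3 * (G.cliqueFinset 3).card ≤ (Fintype.card V - 2 * q) * (G.cliqueFinset 2).card) :
    (∀ v, (G.degree v : ℤ) = Fintype.card V - q) ∧
      ∀ u v w, G.Adj u v → G.Adj u w ∨ G.Adj v w := by
  have h1 : ∑ C ∈ G.cliqueFinset 1, ((G.extensions C).card : ℤ) ^ 2 ≤
      Fintype.card V * (G.cliqueFinset 2).card + 3 * (G.cliqueFinset 3).card := by
    have := G.sum_sq_card_extensions_le 1
    norm_num at this
    exact_mod_cast this
  have hid := G.sum_sq_eq_add 1 (Fintype.card V - q)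
  norm_num at hid
  have h2 : (0 : ℤ) ≤ ∑ C ∈ G.cliqueFinset 1,
      (((G.extensions C).card : ℤ) - (Fintype.card V - q)) ^ 2 :=
    Finset.sum_nonneg fun _ _ => sq_nonneg _
  have h4 := mul_nonneg hq.le (sub_nonneg.2 h)
  have h5 : ∑ C ∈ G.cliqueFinset 1,
      (((G.extensions C).card : ℤ) - (Fintype.card V - q)) ^ 2 = 0 := by linarith
  rw [Finset.sum_eq_zero_iff_of_nonneg fun _ _ => sq_nonneg _] at h5
  constructor
  · intro v
    have hv := h5 {v} (by simp [isNClique_singleton])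
    have hd : (G.extensions {v}).card = G.degree v := by
      rw [← card_neighborFinset_eq_degree]
      congr 1
      ext w
      simp [mem_extensions]
    rw [hd] at hv
    exact sub_eq_zero.1 (pow_eq_zero_iff two_ne_zero |>.1 hv)
  · -- all the exchange counts attain their upper bounds, which are at least one
    have h6 : ∑ A ∈ G.cliqueFinset 2, ∑ v, (A.filter fun u => v ∈ G.extensions (A.erase u)).card =
        ∑ A ∈ G.cliqueFinset 2, ∑ v, (1 + 1 * if v ∈ G.extensions A then 1 else 0) := by
      refine le_antisymm (Finset.sum_le_sum fun A hA => Finset.sum_le_sum fun v _ =>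
        G.card_exchange_le (mem_cliqueFinset_iff.1 hA).card_eq v) ?_
      rw [G.sum_exchange_bound 1, ← G.sum_sq_card_extensions 1]
      zify
      norm_num
      linarith
    have h7 := (Finset.sum_eq_sum_iff_of_le fun A hA => Finset.sum_le_sum fun v _ =>
        G.card_exchange_le (mem_cliqueFinset_iff.1 hA).card_eq v).1 h6
    intro u v w huv
    have hA : ({u, v} : Finset V) ∈ G.cliqueFinset 2 := by
      simp [isNClique_iff, huv, huv.ne]
    have h8 := (Finset.sum_eq_sum_iff_of_le fun v _ =>
        G.card_exchange_le (mem_cliqueFinset_iff.1 hA).card_eq v).1 (h7 _ hA) w (Finset.mem_univ _)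
    have h9 : 0 < (({u, v} : Finset V).filter
        fun x => w ∈ G.extensions (({u, v} : Finset V).erase x)).card := by rw [h8]; positivity
    obtain ⟨x, hx⟩ := Finset.card_pos.1 h9
    simp only [Finset.mem_filter, Finset.mem_insert, Finset.mem_singleton, mem_extensions,
      Finset.mem_erase] at hx
    obtain ⟨rfl | rfl, hx⟩ := hx
    · exact Or.inr (hx v ⟨huv.ne', Or.inr rfl⟩)
    · exact Or.inl (hx u ⟨huv.ne, Or.inl rfl⟩)

end SimpleGraph

/-! ### Fixed and moved edges -/

namespace SimpleGraph

variable {V : Type*} [Fintype V] [DecidableEq V] (G : SimpleGraph V) [DecidableRel G.Adj]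

lemma card_cliqueFinset_one : (G.cliqueFinset 1).card = Fintype.card V := by
  have := G.sum_card_extensions 0
  have h0 : G.cliqueFinset 0 = {∅} := by ext; simp
  rw [h0] at this
  simpa [extensions] using this.symm

lemma two_mul_card_cliqueFinset_two : 2 * (G.cliqueFinset 2).card = ∑ v, G.degree v := by
  rw [← G.sum_card_extensions 1]
  refine (Finset.sum_bij (fun v _ => {v}) ?_ ?_ ?_ ?_).symm
  · simp [isNClique_singleton]
  · simp
  · intro C hC
    rw [mem_cliqueFinset_iff, isNClique_one] at hC
    obtain ⟨a, rfl⟩ := hC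
    exact ⟨a, Finset.mem_univ _, rfl⟩
  · intro v _
    rw [← card_neighborFinset_eq_degree]
    congr 1
    ext w
    simp [mem_extensions]

lemma sum_degree_add_two_mul_card_edgeFinset_compl :
    ∑ v, (G.degree v : ℤ) + 2 * (Gᶜ.edgeFinset.card : ℤ) =
      Fintype.card V * (Fintype.card V - 1) := by
  have h : (∑ v, (Gᶜ.degree v : ℤ)) = 2 * (Gᶜ.edgeFinset.card : ℤ) := by
    exact_mod_cast Gᶜ.sum_degrees_eq_twice_card_edges
  rw [← h, ← Finset.sum_add_distrib]
  have : ∀ v, (G.degree v : ℤ) + Gᶜ.degree v = Fintype.card V - 1 := fun v => by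
    have h1 := G.degree_lt_card_verts v
    rw [degree_compl]
    omega
  simp only [this, Finset.sum_const, Finset.card_univ, nsmul_eq_mul]

lemma card_filter_superset_le {D : Finset V} {r d : ℕ} (hD : D.card = d) :
    ((Finset.univ : Finset (Finset V)).filter fun A => A.card = r ∧ D ⊆ A).card ≤
      Fintype.card V ^ (r - d) := by
  refine le_trans ?_ (Nat.choose_le_pow (Fintype.card V) (r - d))
  rw [← Finset.card_univ, ← Finset.card_powersetCard]
  refine Finset.card_le_card_of_injOn (fun A => A \ D) ?_ ?_
  · intro A hA
    simp only [Finset.coe_filter, Finset.mem_univ, true_and, Set.mem_ofPred_eq] at hA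
    simp [Finset.card_sdiff_of_subset hA.2, hA.1, hD]
  · intro A hA B hB h
    simp only [Finset.coe_filter, Finset.mem_univ, true_and, Set.mem_ofPred_eq] at hA hB
    rw [← Finset.sdiff_union_of_subset hA.2, ← Finset.sdiff_union_of_subset hB.2]
    exact congrArg (· ∪ D) h

end SimpleGraph

namespace EdgeMap

open SimpleGraph

variable {n : ℕ} (f : EdgeMap n)

/-- The graph of the edges `e` with `f e ≠ e`. Its complement is the graph of the edges fixed
by `f`. -/
def movedGraph : SimpleGraph (Fin n) where
  Adj u v := ∃ h : s(u, v) ∈ (⊤ : SimpleGraph (Fin n)).edgeSet, f ⟨s(u, v), h⟩ ≠ ⟨s(u, v), h⟩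
  symm := ⟨fun u v h => by rwa [Sym2.eq_swap]⟩
  loopless := ⟨fun u h => by simpa using h.1⟩

lemma toSubgraph_adj {V : Type*} {H : SimpleGraph V} (c : Copy H (⊤ : SimpleGraph (Fin n)))
    {u v : Fin n} : c.toSubgraph.Adj u v ↔ ∃ a b, H.Adj a b ∧ c a = u ∧ c b = v := by
  simp [Relation.Map]

lemma exists_isFixed {k : ℕ} {T : SimpleGraph (Fin k)} (c : Copy T f.movedGraphᶜ) :
    ∃ S : (⊤ : SimpleGraph (Fin n)).Subgraph, IsCopyOf S T ∧ f.IsFixed S := by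
  set c' : Copy T (⊤ : SimpleGraph (Fin n)) := (Copy.ofLE _ _ le_top).comp c
  refine ⟨c'.toSubgraph, ⟨c'.isoToSubgraph⟩, ?_⟩
  rintro ⟨e, he⟩ heS
  induction e with | _ u v
  obtain ⟨a, b, hab, rfl, rfl⟩ := (toSubgraph_adj c').1 heS
  have h := (compl_adj _ _ _).1 (c.toHom.map_adj hab)
  by_contra hne
  exact h.2 ⟨he, hne⟩

/-- If no copy of `K_r` is `f`-free, then each set of `r` vertices contains an edge together with
its image. -/
lemma exists_image_mem {r : ℕ}
    (h : ¬ ∃ S : (⊤ : SimpleGraph (Fin n)).Subgraph,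
      IsCopyOf S (completeGraph (Fin r)) ∧ f.IsFree S)
    {A : Finset (Fin n)} (hA : A.card = r) :
    ∃ e : (⊤ : SimpleGraph (Fin n)).edgeSet,
      (∀ x ∈ (e : Sym2 (Fin n)), x ∈ A) ∧ ∀ x ∈ (f e : Sym2 (Fin n)), x ∈ A := by
  set c : Copy (completeGraph (Fin r)) (⊤ : SimpleGraph (Fin n)) :=
    ⟨⟨A.orderEmbOfFin hA, fun {a b} hab => (A.orderEmbOfFin hA).injective.ne hab⟩,
      (A.orderEmbOfFin hA).injective⟩
  have hc : ∀ e ∈ c.toSubgraph.edgeSet, ∀ x ∈ e, x ∈ A := by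
    intro e he x hx
    induction e with | _ u v
    obtain ⟨a, b, -, rfl, rfl⟩ := (toSubgraph_adj c).1 he
    rcases Sym2.mem_iff.1 hx with rfl | rfl <;> exact A.orderEmbOfFin_mem hA _
  by_contra! hcon
  refine h ⟨c.toSubgraph, ⟨c.isoToSubgraph⟩, fun e he hfe => ?_⟩
  obtain ⟨x, hx, hxA⟩ := hcon e (hc _ he)
  exact hxA (hc _ hfe x hx)

open Classical in
/-- A moved edge and its image together span at least three vertices. So if no copy of `K_r` is
`f`-free, there is one triple of vertices for each moved edge, such that each `r`-clique of moved
edges contains one of these triples. -/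
lemma exists_triples {r : ℕ}
    (h : ¬ ∃ S : (⊤ : SimpleGraph (Fin n)).Subgraph,
      IsCopyOf S (completeGraph (Fin r)) ∧ f.IsFree S) :
    ∃ D : Finset (Fin n) → Finset (Fin n),
      (∀ B ∈ f.movedGraph.cliqueFinset 2, (D B).card = 3) ∧
      ∀ A ∈ f.movedGraph.cliqueFinset r, ∃ B ∈ f.movedGraph.cliqueFinset 2, D B ⊆ A := by
  have key : ∀ B ∈ f.movedGraph.cliqueFinset 2, ∃ D : Finset (Fin n), D.card = 3 ∧
      ∀ e : (⊤ : SimpleGraph (Fin n)).edgeSet, (e : Sym2 (Fin n)).toFinset = B →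
        ∀ x ∈ D, x ∈ (e : Sym2 (Fin n)) ∨ x ∈ (f e : Sym2 (Fin n)) := by
    intro B hB
    rw [mem_cliqueFinset_iff, isNClique_iff, Finset.card_eq_two] at hB
    obtain ⟨hclq, u, v, huv, rfl⟩ := hB
    obtain ⟨he, hne⟩ : f.movedGraph.Adj u v := hclq (by simp) (by simp) huv
    obtain ⟨w, hw, hwu, hwv⟩ : ∃ w ∈ (f ⟨s(u, v), he⟩ : Sym2 (Fin n)), w ≠ u ∧ w ≠ v := by
      by_contra! hcon
      have hd := (f ⟨s(u, v), he⟩).2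
      refine hne (Subtype.ext ?_)
      generalize (f ⟨s(u, v), he⟩ : Sym2 (Fin n)) = g at hcon hd ⊢
      induction g with | _ a b
      have h1 := hcon a (by simp)
      have h2 := hcon b (by simp)
      simp only [mem_edgeSet, top_adj] at hd
      simp only [Sym2.eq_iff]
      grind
    refine ⟨{u, v, w}, Finset.card_eq_three.2 ⟨u, v, w, huv, hwu.symm, hwv.symm, rfl⟩, ?_⟩
    rintro ⟨e, he'⟩ heB x hx
    obtain rfl : e = s(u, v) := by
      refine Sym2.ext fun y => ?_
      rw [← Sym2.mem_toFinset, heB]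
      simp
    simp only [Finset.mem_insert, Finset.mem_singleton] at hx
    rcases hx with rfl | rfl | rfl
    · simp
    · simp
    · exact Or.inr hw
  choose! D hD3 hD using key
  refine ⟨D, hD3, fun A hA => ?_⟩
  rw [mem_cliqueFinset_iff] at hA
  obtain ⟨e, he, hfe⟩ := f.exists_image_mem h hA.card_eq
  have hB : (e : Sym2 (Fin n)).toFinset ∈ f.movedGraph.cliqueFinset 2 := by
    rw [mem_cliqueFinset_iff, isNClique_iff,
      Sym2.card_toFinset_of_not_isDiag _ (not_isDiag_of_mem_edgeSet _ e.2)]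
    exact ⟨hA.isClique.subset fun x hx => he x (by simpa using hx), rfl⟩
  exact ⟨_, hB, fun x hx => (hD _ hB e rfl x hx).elim (he x) (hfe x)⟩

open Classical in
/-- Each moved edge destroys at most `n ^ (r - 3)` of the `r`-cliques. -/
lemma card_cliqueFinset_le_of_not_isFree {r : ℕ}
    (h : ¬ ∃ S : (⊤ : SimpleGraph (Fin n)).Subgraph,
      IsCopyOf S (completeGraph (Fin r)) ∧ f.IsFree S) :
    (f.movedGraph.cliqueFinset r).card ≤ (f.movedGraph.cliqueFinset 2).card * n ^ (r - 3) := by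
  obtain ⟨D, hD3, hD⟩ := f.exists_triples h
  calc (f.movedGraph.cliqueFinset r).card
      ≤ ((f.movedGraph.cliqueFinset 2).biUnion fun B =>
          (Finset.univ : Finset (Finset (Fin n))).filter fun A => A.card = r ∧ D B ⊆ A).card := by
        refine Finset.card_le_card fun A hA => ?_
        obtain ⟨B, hB, hBA⟩ := hD A hA
        exact Finset.mem_biUnion.2 ⟨B, hB, Finset.mem_filter.2
          ⟨Finset.mem_univ _, (mem_cliqueFinset_iff.1 hA).card_eq, hBA⟩⟩
    _ ≤ (f.movedGraph.cliqueFinset 2).card * n ^ (r - 3) := by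
        refine Finset.card_biUnion_le_card_mul _ _ _ fun B hB => ?_
        simpa using card_filter_superset_le (r := r) (hD3 B hB)

open Classical in
lemma card_cliqueFinset_two_eq_zero
    (h : ¬ ∃ S : (⊤ : SimpleGraph (Fin n)).Subgraph,
      IsCopyOf S (completeGraph (Fin 2)) ∧ f.IsFree S) :
    (f.movedGraph.cliqueFinset 2).card = 0 := by
  obtain ⟨D, hD3, hD⟩ := f.exists_triples h
  refine Finset.card_eq_zero.2 (Finset.eq_empty_of_forall_notMem fun A hA => ?_)
  obtain ⟨B, hB, hBA⟩ := hD A hA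
  have := Finset.card_le_card hBA
  rw [hD3 B hB, (mem_cliqueFinset_iff.1 hA).card_eq] at this
  omega

open Classical in
/-- If no copy of `T` is `f`-fixed, then the moved edges have average degree at
least `n - (k - 1)`. -/
lemma le_card_cliqueFinset_two {k : ℕ} {T : SimpleGraph (Fin k)} (hT : IsErdosSosTree T)
    (h : ¬ ∃ S : (⊤ : SimpleGraph (Fin n)).Subgraph, IsCopyOf S T ∧ f.IsFixed S) :
    ((n : ℤ) - (k - 1)) * n ≤ 2 * (f.movedGraph.cliqueFinset 2).card := by
  have hfree : T.Free f.movedGraphᶜ := fun ⟨c⟩ => h (f.exists_isFixed c)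
  have h1 := card_edgeFinset_le_extremalNumber hfree
  rw [Fintype.card_fin] at h1
  have h2 : (f.movedGraphᶜ.edgeFinset.card : ℝ) ≤ ((k : ℝ) - 2) / 2 * (n : ℝ) :=
    le_trans (by exact_mod_cast h1) (hT.2 n)
  have h3 : 2 * (f.movedGraphᶜ.edgeFinset.card : ℤ) ≤ ((k : ℤ) - 2) * n := by
    have : 2 * (f.movedGraphᶜ.edgeFinset.card : ℝ) ≤ ((k : ℝ) - 2) * n := by linarith
    exact_mod_cast this
  have h4 := f.movedGraph.sum_degree_add_two_mul_card_edgeFinset_compl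
  have h5 : 2 * ((f.movedGraph.cliqueFinset 2).card : ℤ) = ∑ v, (f.movedGraph.degree v : ℤ) := by
    exact_mod_cast f.movedGraph.two_mul_card_cliqueFinset_two
  rw [Fintype.card_fin] at h4
  linarith

end EdgeMap

/-! ### Upper bounds -/

section UpperBounds

open SimpleGraph

lemma mNumber_le {V W : Type*} {G : SimpleGraph V} {H : SimpleGraph W} {m : ℕ}
    (h : ∀ N, m ≤ N → FixedOrFree N G H) : mNumber G H ≤ m :=
  iInf₂_le m h

namespace EdgeMap

variable {n k : ℕ} (f : EdgeMap n) {T : SimpleGraph (Fin k)}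

open Classical in
lemma movedGraph_moonMoser (hk : 2 ≤ k) (hT : IsErdosSosTree T)
    (h : ¬ ∃ S : (⊤ : SimpleGraph (Fin n)).Subgraph, IsCopyOf S T ∧ f.IsFixed S)
    {s : ℕ} (hs : 1 ≤ s) (hsn : (s : ℤ) * (k - 1) ≤ n) :
    ((n : ℤ) - s * (k - 1)) * (f.movedGraph.cliqueFinset s).card ≤
      (s + 1) * (f.movedGraph.cliqueFinset (s + 1)).card := by
  have h1 := f.movedGraph.moonMoser (q := k - 1)
    (by rw [card_cliqueFinset_one, Fintype.card_fin]; exact f.le_card_cliqueFinset_two hT h)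
    (by omega) hs (by rwa [Fintype.card_fin])
  rwa [Fintype.card_fin] at h1

open Classical in
lemma card_cliqueFinset_two_pos (hk : 2 ≤ k) (hT : IsErdosSosTree T)
    (h : ¬ ∃ S : (⊤ : SimpleGraph (Fin n)).Subgraph, IsCopyOf S T ∧ f.IsFixed S) (hn : k ≤ n) :
    0 < (f.movedGraph.cliqueFinset 2).card := by
  have h1 := f.le_card_cliqueFinset_two hT h
  have h2 : (0 : ℤ) < ((n : ℤ) - (k - 1)) * n := mul_pos (by omega) (by omega)
  omega

end EdgeMap

variable {k : ℕ} {T : SimpleGraph (Fin k)}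

lemma fixedOrFree_completeGraph_two (hk : 2 ≤ k) (hT : IsErdosSosTree T) {n : ℕ} (hn : k ≤ n) :
    FixedOrFree n T (completeGraph (Fin 2)) := by
  intro f
  by_contra! hcon
  obtain ⟨h1, h2⟩ := hcon
  have := f.card_cliqueFinset_two_pos hk hT (by simpa using h1) hn
  exact this.ne' (f.card_cliqueFinset_two_eq_zero (by simpa using h2))

open Classical in
/-- With `c = n - (r - 1) * (k - 1)`, the number of `r`-cliques of moved edges is at least `c / r`
times that of the `(r - 1)`-cliques, and this is at least a constant times `n ^ (r - 3)` times the
number of moved edges. -/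
lemma fixedOrFree_completeGraph (hk : 2 ≤ k) (hT : IsErdosSosTree T) {j n : ℕ}
    (hn : (j + 2) * (k - 1) + ((j + 3) * ((j + 2) * (j + 2)) ^ j + 1) ≤ n) :
    FixedOrFree n T (completeGraph (Fin (j + 3))) := by
  intro f
  by_contra! hcon
  obtain ⟨h1, h2⟩ := hcon
  have h1' : ¬ ∃ S : (⊤ : SimpleGraph (Fin n)).Subgraph, IsCopyOf S T ∧ f.IsFixed S := by
    simpa using h1
  have h2' : ¬ ∃ S : (⊤ : SimpleGraph (Fin n)).Subgraph,
      IsCopyOf S (completeGraph (Fin (j + 3))) ∧ f.IsFree S := by simpa using h2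
  obtain ⟨q, rfl⟩ : ∃ q, k = q + 1 := ⟨k - 1, by omega⟩
  rw [Nat.add_sub_cancel] at hn
  have hkn : q + 1 ≤ n := by
    have : q ≤ (j + 2) * q := Nat.le_mul_of_pos_left q (by omega)
    omega
  have hpos := f.card_cliqueFinset_two_pos hk hT h1' hkn
  have hkill := f.card_cliqueFinset_le_of_not_isFree h2'
  set N : ℕ → ℕ := fun s => (f.movedGraph.cliqueFinset s).card with hN
  change 0 < N 2 at hpos
  change N (j + 3) ≤ N 2 * n ^ (j + 3 - 3) at hkill
  rw [Nat.add_sub_cancel] at hkill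
  have hMM : ∀ s, 1 ≤ s → s ≤ j + 2 → ((n : ℤ) - s * q) * N s ≤ (s + 1) * N (s + 1) := by
    intro s hs hsj
    have hsn : s * q ≤ n := le_trans (Nat.mul_le_mul_right q hsj) (by omega)
    have := f.movedGraph_moonMoser hk hT h1' hs (by push_cast; simpa using mod_cast hsn)
    push_cast at this
    simpa using this
  have hgrow : ∀ i, i ≤ j → n ^ i * N 2 ≤ ((j + 2) * (j + 2)) ^ i * N (i + 2) := by
    intro i
    induction i with
    | zero => simp
    | succ i ih =>
      intro hi
      have h3 := hMM (i + 2) (by omega) (by omega)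
      -- as `n ≥ (j + 2) * q` and `i + 2 ≤ j + 1`, we have `(j + 2) * (n - (i + 2) * q) ≥ n`
      have h4 : (n : ℤ) ≤ (j + 2) * ((n : ℤ) - (i + 2 : ℕ) * q) := by
        have h5 : ((j : ℤ) + 2) * q ≤ n := by exact_mod_cast (by omega : (j + 2) * q ≤ n)
        have h6 : ((i + 2 : ℕ) : ℤ) ≤ j + 1 := by push_cast; omega
        have h7 : (0 : ℤ) ≤ (i + 2 : ℕ) := by positivity
        have h8 : (0 : ℤ) ≤ n := by positivity
        nlinarith [mul_le_mul_of_nonneg_left h5 h7, mul_le_mul_of_nonneg_right h6 h8]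
      have h9 : n * N (i + 2) ≤ (j + 2) * (j + 2) * N (i + 3) := by
        zify
        have h10 : (n : ℤ) * N (i + 2) ≤ (j + 2) * ((n : ℤ) - (i + 2 : ℕ) * q) * N (i + 2) :=
          mul_le_mul_of_nonneg_right h4 (by positivity)
        have h11 : ((i + 2 : ℕ) + 1 : ℤ) * N (i + 3) ≤ (j + 2) * N (i + 3) :=
          mul_le_mul_of_nonneg_right (by push_cast; omega) (by positivity)
        have h12 := mul_le_mul_of_nonneg_left (h3.trans h11) (by positivity : (0 : ℤ) ≤ j + 2)
        linarith
      calc n ^ (i + 1) * N 2 = n * (n ^ i * N 2) := by ring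
        _ ≤ n * (((j + 2) * (j + 2)) ^ i * N (i + 2)) := Nat.mul_le_mul_left _ (ih (by omega))
        _ = ((j + 2) * (j + 2)) ^ i * (n * N (i + 2)) := by ring
        _ ≤ ((j + 2) * (j + 2)) ^ i * ((j + 2) * (j + 2) * N (i + 3)) :=
          Nat.mul_le_mul_left _ h9
        _ = ((j + 2) * (j + 2)) ^ (i + 1) * N (i + 1 + 2) := by ring_nf
  have hlast := hMM (j + 2) (by omega) le_rfl
  have hg := hgrow j le_rfl
  have hNpos : 0 < N (j + 2) := by
    by_contra h0
    have h0' : N (j + 2) = 0 := by omega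
    rw [h0', mul_zero] at hg
    have : 0 < n ^ j * N 2 := mul_pos (pow_pos (by omega) _) hpos
    omega
  have h5 : (j + 3) * N (j + 3) ≤ (j + 3) * (((j + 2) * (j + 2)) ^ j * N (j + 2)) :=
    Nat.mul_le_mul_left _ (hkill.trans (by rwa [mul_comm]))
  have h6 : (((j + 3) * ((j + 2) * (j + 2)) ^ j + 1 : ℕ) : ℤ) ≤ (n : ℤ) - (j + 2 : ℕ) * q := by
    have : (((j + 2) * q + ((j + 3) * ((j + 2) * (j + 2)) ^ j + 1) : ℕ) : ℤ) ≤ n := by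
      exact_mod_cast hn
    push_cast at this ⊢
    linarith
  have h7 : (((j + 3) * ((j + 2) * (j + 2)) ^ j + 1 : ℕ) : ℤ) * N (j + 2) ≤
      ((j + 3) * (((j + 2) * (j + 2)) ^ j * N (j + 2)) : ℕ) := by
    refine (mul_le_mul_of_nonneg_right h6 (by positivity)).trans (hlast.trans ?_)
    refine le_trans (le_of_eq ?_) (Int.ofNat_le.2 h5)
    push_cast
    ring
  have h8 : ((j + 3) * ((j + 2) * (j + 2)) ^ j + 1) * N (j + 2) ≤
      (j + 3) * (((j + 2) * (j + 2)) ^ j * N (j + 2)) := by exact_mod_cast h7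
  rw [← mul_assoc] at h8
  have := Nat.le_of_mul_le_mul_right h8 hNpos
  omega

lemma exists_mNumber_completeGraph_le {r : ℕ} (hr : 2 ≤ r) :
    ∃ c : ℕ, ∀ k : ℕ, 2 ≤ k → ∀ T : SimpleGraph (Fin k), IsErdosSosTree T →
      mNumber T (completeGraph (Fin r)) ≤ (((r - 1) * (k - 1) + c : ℕ) : ℕ∞) := by
  obtain rfl | ⟨j, rfl⟩ : r = 2 ∨ ∃ j, r = j + 3 := by
    by_cases h : r = 2
    · exact Or.inl h
    · exact Or.inr ⟨r - 3, by omega⟩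
  · exact ⟨1, fun k hk T hT => mNumber_le fun N hN =>
      fixedOrFree_completeGraph_two hk hT (by omega)⟩
  · exact ⟨_, fun k hk T hT => mNumber_le fun N hN => fixedOrFree_completeGraph hk hT hN⟩

open Classical in
lemma fixedOrFree_completeGraph_four (hk : 2 ≤ k) (hT : IsErdosSosTree T) {n : ℕ}
    (hn : 3 * k + 33 ≤ n) : FixedOrFree n T (completeGraph (Fin 4)) := by
  intro f
  by_contra! hcon
  obtain ⟨h1, h2⟩ := hcon
  have h1' : ¬ ∃ S : (⊤ : SimpleGraph (Fin n)).Subgraph, IsCopyOf S T ∧ f.IsFixed S := by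
    simpa using h1
  have hpos := f.card_cliqueFinset_two_pos hk hT h1' (by omega)
  have hkill := f.card_cliqueFinset_le_of_not_isFree (r := 4) (by simpa using h2)
  have h3 := f.movedGraph_moonMoser hk hT h1' (s := 2) (by norm_num) (by omega)
  have h4 := f.movedGraph_moonMoser hk hT h1' (s := 3) (by norm_num) (by omega)
  zify at hkill hpos hn hk
  norm_num at hkill h3 h4
  set N₂ : ℤ := ((f.movedGraph.cliqueFinset 2).card : ℤ)
  set N₃ : ℤ := ((f.movedGraph.cliqueFinset 3).card : ℤ)
  have h5 : 36 * N₃ ≤ ((n : ℤ) - 3 * (k - 1)) * N₃ :=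
    mul_le_mul_of_nonneg_right (by linarith) (Int.natCast_nonneg _)
  have h6 : ((n : ℤ) + 72) * N₂ ≤ 3 * (((n : ℤ) - 2 * (k - 1)) * N₂) := by
    rw [← mul_assoc]
    exact mul_le_mul_of_nonneg_right (by linarith) hpos.le
  linarith

end UpperBounds

/-! ### The exceptional trees -/

section Exceptional

open SimpleGraph

lemma nonempty_iso_completeGraph_two {T : SimpleGraph (Fin 2)} (hT : T.IsTree) :
    Nonempty (T ≃g completeGraph (Fin 2)) := by
  have h : T = ⊤ := by
    have h01 : T.Adj 0 1 := by
      obtain ⟨v, hv⟩ := hT.connected.preconnected.exists_adj_of_nontrivial 0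
      fin_cases v
      · exact absurd hv (T.loopless.irrefl _)
      · exact hv
    ext u v
    fin_cases u <;> fin_cases v <;> simp [h01, h01.symm]
  rw [h]
  exact ⟨Iso.refl⟩

/-- The adjacency matrix of the graph on `Fin 4` with edge indicators `b`, in the order
`01, 02, 03, 12, 13, 23`. -/
def fourAdj (b : Fin 6 → Bool) : Fin 4 → Fin 4 → Bool :=
  ![![false, b 0, b 1, b 2], ![b 0, false, b 3, b 4], ![b 1, b 3, false, b 5],
    ![b 2, b 4, b 5, false]]

/-- A graph on four vertices with three edges and no isolated vertex is a star or a path. -/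
lemma fourAdj_classification : ∀ b : Fin 6 → Bool,
    ∑ i, ∑ j, (fourAdj b i j).toNat = 6 → (∀ i, ∃ j, fourAdj b i j = true) →
    ∃ σ : Equiv.Perm (Fin 4),
      (∀ i j, fourAdj b (σ i) (σ j) = true ↔ (i = 0 ∧ j ≠ 0 ∨ i ≠ 0 ∧ j = 0)) ∨
      (∀ i j, fourAdj b (σ i) (σ j) = true ↔ (i.val + 1 = j.val ∨ j.val + 1 = i.val)) := by
  decide +kernel

lemma isExceptionalTree_of_four {T : SimpleGraph (Fin 4)} (hT : T.IsTree) :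
    IsExceptionalTree T := by
  classical
  obtain ⟨b, hb⟩ : ∃ b, ∀ i j, T.Adj i j ↔ fourAdj b i j = true := by
    refine ⟨![decide (T.Adj 0 1), decide (T.Adj 0 2), decide (T.Adj 0 3), decide (T.Adj 1 2),
      decide (T.Adj 1 3), decide (T.Adj 2 3)], fun i j => ?_⟩
    fin_cases i <;> fin_cases j <;> simp [fourAdj] <;> exact T.adj_comm _ _
  have hdeg : ∀ i, T.degree i = ∑ j, (fourAdj b i j).toNat := fun i => by
    rw [← card_neighborFinset_eq_degree, neighborFinset_eq_filter, Finset.card_filter]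
    refine Finset.sum_congr rfl fun j _ => ?_
    rw [hb]
    cases fourAdj b i j <;> simp
  have hsum : ∑ i, ∑ j, (fourAdj b i j).toNat = 6 := by
    have h1 := hT.card_edgeFinset
    have h2 := T.sum_degrees_eq_twice_card_edges
    simp only [hdeg, Fintype.card_fin] at h1 h2
    omega
  obtain ⟨σ, hσ | hσ⟩ := fourAdj_classification b hsum fun i => by
    simpa only [hb] using hT.connected.preconnected.exists_adj_of_nontrivial i
  · refine Or.inr (Or.inl ⟨(Iso.symm ⟨finSumFinEquiv.trans σ, fun {x y} => ?_⟩)⟩)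
    rw [hb]
    refine (hσ _ _).trans ?_
    rw [completeBipartiteGraph_adj]
    revert x y
    decide
  · refine Or.inr (Or.inr ⟨(Iso.symm ⟨σ, fun {x y} => ?_⟩)⟩)
    rw [hb, pathGraph_adj]
    exact hσ x y

lemma isExceptionalTree_of_dvd {k : ℕ} (hk : 2 ≤ k) {T : SimpleGraph (Fin k)} (hT : T.IsTree)
    (h : k - 1 ∣ 2 * k + 1) : IsExceptionalTree T := by
  have h3 : k - 1 ∣ 3 := by
    rw [show 2 * k + 1 = 2 * (k - 1) + 3 by omega] at h
    exact (Nat.dvd_add_right (Dvd.intro_left 2 rfl)).1 h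
  obtain h | h := (Nat.dvd_prime Nat.prime_three).1 h3
  · obtain rfl : k = 2 := by omega
    exact Or.inl (nonempty_iso_completeGraph_two hT)
  · obtain rfl : k = 4 := by omega
    exact isExceptionalTree_of_four hT

lemma IsExceptionalTree.eq_two_or_four {k : ℕ} {T : SimpleGraph (Fin k)}
    (h : IsExceptionalTree T) : k = 2 ∨ k = 4 := by
  obtain ⟨⟨e⟩⟩ | ⟨⟨e⟩⟩ | ⟨⟨e⟩⟩ := h
  all_goals
    have := Fintype.card_congr e.toEquiv
    simp at this
    omega

open Classical in
/-- If non-adjacency is transitive, then its classes partition the vertices; in a regular graph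
they all have the same size. -/
lemma dvd_card_of_regular {V : Type*} [Fintype V] {G : SimpleGraph V} {d : ℕ}
    (hd : ∀ v, G.degree v = d) (h : ∀ u v w, G.Adj u v → G.Adj u w ∨ G.Adj v w) :
    Fintype.card V - d ∣ Fintype.card V := by
  let cls : V → Finset V := fun v => (G.neighborFinset v)ᶜ
  have hcls : ∀ v w, cls w = cls v ↔ w ∈ cls v := by
    intro v w
    constructor
    · intro hvw
      rw [← hvw]
      simp [cls]
    · intro hvw
      simp only [cls, Finset.mem_compl, mem_neighborFinset] at hvw
      ext x
      simp only [cls, Finset.mem_compl, mem_neighborFinset, not_iff_not]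
      constructor
      · intro hwx
        exact (h w x v hwx).elim (fun h' => absurd h'.symm hvw) Adj.symm
      · intro hvx
        exact (h v x w hvx).elim (fun h' => absurd h' hvw) Adj.symm
  have hcard : ∀ v, (cls v).card = Fintype.card V - d := by
    intro v
    rw [← hd v, ← card_neighborFinset_eq_degree, ← Finset.card_compl]
  conv_rhs => rw [← Finset.card_univ, Finset.card_eq_sum_card_image cls]
  refine Finset.dvd_sum fun C hC => ?_
  obtain ⟨v, -, rfl⟩ := Finset.mem_image.1 hC
  simp only [hcls, Finset.filter_mem_eq_inter, Finset.univ_inter, hcard, dvd_refl]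

variable {k : ℕ} {T : SimpleGraph (Fin k)}

lemma fixedOrFree_completeGraph_three (hk : 2 ≤ k) (hT : IsErdosSosTree T) {n : ℕ}
    (hn : 2 * k + 2 ≤ n) : FixedOrFree n T (completeGraph (Fin 3)) := by
  classical
  intro f
  by_contra! hcon
  obtain ⟨h1, h2⟩ := hcon
  have h1' : ¬ ∃ S : (⊤ : SimpleGraph (Fin n)).Subgraph, IsCopyOf S T ∧ f.IsFixed S := by
    simpa using h1
  have hpos := f.card_cliqueFinset_two_pos hk hT h1' (by omega)
  have hkill := f.card_cliqueFinset_le_of_not_isFree (r := 3) (by simpa using h2)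
  have h3 := f.movedGraph_moonMoser hk hT h1' (s := 2) (by norm_num) (by omega)
  zify at hkill hpos hn hk
  norm_num at hkill h3
  have h4 : 4 * ((f.movedGraph.cliqueFinset 2).card : ℤ) ≤
      ((n : ℤ) - 2 * (k - 1)) * (f.movedGraph.cliqueFinset 2).card :=
    mul_le_mul_of_nonneg_right (by linarith) hpos.le
  linarith

/-- For `n = 2 * k + 1` a counterexample attains equality in the Moon–Moser inequality, so that
its fixed edges form disjoint cliques on `k - 1` vertices each. -/
lemma isExceptionalTree_of_not_fixedOrFree (hk : 2 ≤ k) (hT : IsErdosSosTree T)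
    (h : ¬ FixedOrFree (2 * k + 1) T (completeGraph (Fin 3))) : IsExceptionalTree T := by
  classical
  refine isExceptionalTree_of_dvd hk hT.1 ?_
  simp only [FixedOrFree, not_forall, not_or] at h
  obtain ⟨f, h1, h2⟩ := h
  have hkill := f.card_cliqueFinset_le_of_not_isFree h2
  have hedge := f.le_card_cliqueFinset_two hT h1
  rw [Nat.sub_self, pow_zero, mul_one] at hkill
  obtain ⟨hdeg, htrans⟩ := f.movedGraph.moonMoser_triangle_eq (q := k - 1)
    (by rw [Fintype.card_fin]; push_cast; linarith)
    (by rwa [card_cliqueFinset_one, Fintype.card_fin])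
    (by
      rw [Fintype.card_fin, show ((2 * k + 1 : ℕ) : ℤ) - 2 * (k - 1) = 3 by push_cast; ring]
      exact_mod_cast Nat.mul_le_mul_left 3 hkill)
  have hd : ∀ v, f.movedGraph.degree v = k + 2 := fun v => by
    have := hdeg v
    rw [Fintype.card_fin] at this
    omega
  have := dvd_card_of_regular hd htrans
  rw [Fintype.card_fin] at this
  rwa [show 2 * k + 1 - (k + 2) = k - 1 by omega] at this

end Exceptional

/-! ### Lower bounds -/

section LowerBounds

open SimpleGraph

lemma le_mNumber {V W : Type*} {G : SimpleGraph V} {H : SimpleGraph W} {n : ℕ}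
    (h : ¬ FixedOrFree n G H) : ((n + 1 : ℕ) : ℕ∞) ≤ mNumber G H :=
  le_iInf₂ fun m hm => by
    by_contra hlt
    exact h (hm n (by have := Nat.cast_lt.1 (not_le.1 hlt); omega))

namespace EdgeMap

variable {n k q : ℕ}

/-- The colour of a vertex: consecutive intervals of length `q` receive the same colour. -/
def blockColor (q : ℕ) (v : Fin n) : ℕ := v.val / q

/-- If all fixed edges lie inside the intervals of length `k - 1`, then there is no fixed copy of a
connected graph on `k` vertices, as it would lie in one interval. -/
lemma not_exists_isFixed (hk : 2 ≤ k) {T : SimpleGraph (Fin k)} (hT : T.Connected)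
    {f : EdgeMap n}
    (hf : ∀ e, f e = e → ∀ u ∈ (e : Sym2 (Fin n)), ∀ v ∈ (e : Sym2 (Fin n)),
      blockColor (k - 1) u = blockColor (k - 1) v) :
    ¬ ∃ S : (⊤ : SimpleGraph (Fin n)).Subgraph, IsCopyOf S T ∧ f.IsFixed S := by
  rintro ⟨S, ⟨φ⟩, hS⟩
  have hadj : ∀ a b, T.Adj a b →
      blockColor (k - 1) (φ a : Fin n) = blockColor (k - 1) (φ b : Fin n) := by
    intro a b hab
    have hSab : S.Adj (φ a) (φ b) := φ.map_rel_iff.2 hab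
    exact hf ⟨s((φ a : Fin n), (φ b : Fin n)), hSab.adj_sub⟩ (hS _ hSab) _ (by simp) _ (by simp)
  have hconst : ∀ a b, blockColor (k - 1) (φ a : Fin n) = blockColor (k - 1) (φ b : Fin n) := by
    intro a b
    obtain ⟨p⟩ := hT.preconnected a b
    induction p with
    | nil => rfl
    | cons h _ ih => exact (hadj _ _ h).trans ih
  obtain ⟨a, b, hab, hmod⟩ := Fintype.exists_ne_map_eq_of_card_lt
    (fun a : Fin k => (⟨(φ a : Fin n).val % (k - 1), Nat.mod_lt _ (by omega)⟩ : Fin (k - 1)))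
    (by simp; omega)
  refine hab (φ.injective (Subtype.ext (Fin.ext ?_)))
  rw [← Nat.div_add_mod (φ a : Fin n).val (k - 1), ← Nat.div_add_mod (φ b : Fin n).val (k - 1)]
  exact congrArg₂ (fun x y => (k - 1) * x + y) (hconst a b) (Fin.mk.inj_iff.1 hmod)

/-- The vertices of a copy of `K_r`. -/
lemma exists_vertices {r : ℕ} {S : (⊤ : SimpleGraph (Fin n)).Subgraph}
    (hS : IsCopyOf S (completeGraph (Fin r))) :
    ∃ φ : Fin r → Fin n, Function.Injective φ ∧ ∀ a b, a ≠ b → S.Adj (φ a) (φ b) := by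
  obtain ⟨φ⟩ := hS
  exact ⟨fun a => φ a, Subtype.val_injective.comp φ.injective, fun a b hab => φ.map_rel_iff.2 hab⟩

/-- The fixed edges are those inside the intervals of length `q`; every other edge is mapped to an
arbitrary different edge. -/
lemma exists_fixing_blocks (h : 3 ≤ n ∨ ∀ u v : Fin n, blockColor q u = blockColor q v) :
    ∃ f : EdgeMap n, ∀ e, f e = e ↔ ∀ u ∈ (e : Sym2 (Fin n)), ∀ v ∈ (e : Sym2 (Fin n)),
      blockColor q u = blockColor q v := by
  have key : ∀ e : (⊤ : SimpleGraph (Fin n)).edgeSet, ∃ e' : (⊤ : SimpleGraph (Fin n)).edgeSet,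
      e' = e ↔ ∀ u ∈ (e : Sym2 (Fin n)), ∀ v ∈ (e : Sym2 (Fin n)),
        blockColor q u = blockColor q v := by
    rintro ⟨e, he⟩
    induction e with | _ u v
    obtain h | h := h
    · obtain ⟨w, hw⟩ : ∃ w, w ∉ ({u, v} : Finset (Fin n)) := by
        by_contra! hall
        have h1 := Finset.card_le_card fun x (_ : x ∈ Finset.univ) => hall x
        have h2 := Finset.card_le_two (a := u) (b := v)
        rw [Finset.card_univ, Fintype.card_fin] at h1
        omega
      simp only [Finset.mem_insert, Finset.mem_singleton, not_or] at hw
      by_cases hm : ∀ x ∈ s(u, v), ∀ y ∈ s(u, v), blockColor q x = blockColor q y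
      · exact ⟨_, iff_of_true rfl hm⟩
      · refine ⟨⟨s(u, w), Ne.symm hw.1⟩, iff_of_false (fun heq => ?_) hm⟩
        have := congrArg Subtype.val heq
        simp only [Sym2.congr_right] at this
        exact hw.2 this
    · exact ⟨_, iff_of_true rfl fun x _ y _ => h x y⟩
  choose f hf using key
  exact ⟨f, hf⟩

/-- Each edge `uv` with ends in different intervals is mapped into the triangle on `u`, `v` and
`t u v`. If every triangle with vertices in three intervals arises from one of its edges in this
way, then there is no free triangle. -/
lemma exists_not_isFree_triangle (t : Fin n → Fin n → Fin n) (hsymm : ∀ u v, t u v = t v u)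
    (hne : ∀ u v, blockColor q u ≠ blockColor q v → t u v ≠ u)
    (htri : ∀ x y z, blockColor q x ≠ blockColor q y → blockColor q x ≠ blockColor q z →
      blockColor q y ≠ blockColor q z → t x y = z ∨ t x z = y ∨ t y z = x) :
    ∃ f : EdgeMap n, (∀ e, f e = e → ∀ u ∈ (e : Sym2 (Fin n)), ∀ v ∈ (e : Sym2 (Fin n)),
      blockColor q u = blockColor q v) ∧
      ¬ ∃ S : (⊤ : SimpleGraph (Fin n)).Subgraph,
        IsCopyOf S (completeGraph (Fin 3)) ∧ f.IsFree S := by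
  have key : ∀ e : (⊤ : SimpleGraph (Fin n)).edgeSet, ∃ e' : (⊤ : SimpleGraph (Fin n)).edgeSet,
      (e' = e → ∀ u ∈ (e : Sym2 (Fin n)), ∀ v ∈ (e : Sym2 (Fin n)),
        blockColor q u = blockColor q v) ∧
      ∀ u v, (e : Sym2 (Fin n)) = s(u, v) →
        (blockColor q u = blockColor q v → e' = e) ∧
        ∀ x ∈ (e' : Sym2 (Fin n)), x = u ∨ x = v ∨ x = t u v := by
    rintro ⟨e, he⟩
    induction e with | _ u v
    by_cases huv : blockColor q u = blockColor q v
    · refine ⟨⟨s(u, v), he⟩, fun _ x hx y hy => ?_, fun x y hxy => ⟨fun _ => rfl, fun z hz => ?_⟩⟩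
      · rw [Sym2.mem_iff] at hx hy
        rcases hx with rfl | rfl <;> rcases hy with rfl | rfl <;> simp [huv]
      · change z ∈ s(u, v) at hz
        rw [show s(u, v) = s(x, y) from hxy, Sym2.mem_iff] at hz
        tauto
    · refine ⟨⟨s(u, t u v), (hne u v huv).symm⟩, fun heq => ?_, fun x y hxy =>
        ⟨fun hc => ?_, fun z hz => ?_⟩⟩
      · have := congrArg Subtype.val heq
        simp only [Sym2.congr_right] at this
        exact absurd this (by rw [hsymm]; exact hne v u (Ne.symm huv))
      · rcases Sym2.eq_iff.1 hxy with ⟨rfl, rfl⟩ | ⟨rfl, rfl⟩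
        · exact absurd hc huv
        · exact absurd hc.symm huv
      · rw [Sym2.mem_iff] at hz
        rcases Sym2.eq_iff.1 hxy with ⟨rfl, rfl⟩ | ⟨rfl, rfl⟩
        · tauto
        · rw [hsymm v u]
          tauto
  choose f hfix hf using key
  refine ⟨f, hfix, ?_⟩
  rintro ⟨S, hS, hfree⟩
  obtain ⟨φ, hφ, hadj⟩ := exists_vertices hS
  have hcol : ∀ a b, a ≠ b → blockColor q (φ a) ≠ blockColor q (φ b) := by
    intro a b hab hc
    have hab' := hadj a b hab
    refine hfree ⟨s(φ a, φ b), hab'.adj_sub⟩ hab' ?_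
    rw [(hf _ _ _ rfl).1 hc]
    exact hab'
  have hclose : ∀ a b c, a ≠ b → t (φ a) (φ b) ≠ φ c := by
    intro a b c hab ht
    have hab' := hadj a b hab
    refine hfree ⟨s(φ a, φ b), hab'.adj_sub⟩ hab' ?_
    have hmem := (hf ⟨s(φ a, φ b), hab'.adj_sub⟩ _ _ rfl).2
    rw [ht] at hmem
    have hd := (f ⟨s(φ a, φ b), hab'.adj_sub⟩).2
    generalize (f ⟨s(φ a, φ b), hab'.adj_sub⟩ : Sym2 (Fin n)) = g at hmem hd ⊢
    induction g with | _ x y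
    obtain ⟨i, rfl⟩ : ∃ i, φ i = x := by
      rcases hmem x (by simp) with rfl | rfl | rfl <;> exact ⟨_, rfl⟩
    obtain ⟨j, rfl⟩ : ∃ j, φ j = y := by
      rcases hmem y (by simp) with rfl | rfl | rfl <;> exact ⟨_, rfl⟩
    exact hadj i j fun hij => hd (congrArg φ hij)
  rcases htri (φ 0) (φ 1) (φ 2) (hcol _ _ (by decide)) (hcol _ _ (by decide))
    (hcol _ _ (by decide)) with h | h | h
  · exact hclose _ _ _ (by decide) h
  · exact hclose _ _ _ (by decide) h
  · exact hclose _ _ _ (by decide) h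

end EdgeMap

open EdgeMap

variable {k : ℕ} {T : SimpleGraph (Fin k)}

/-- In `K_5` the ten edges correspond to the ten triangles, by adding to an edge of `ZMod 5` its
midpoint. In the complement of three disjoint triangles, the 27 edges correspond to the 27
triangles as follows: in terms of the position modulo 3 inside each part, a triangle whose
positions add up to `i` is assigned to its edge that avoids the part `i`. -/
lemma not_fixedOrFree_completeGraph_three (hk : k = 2 ∨ k = 4) (hT : T.IsTree) :
    ¬ FixedOrFree (2 * k + 1) T (completeGraph (Fin 3)) := by
  have hk2 : 2 ≤ k := by omega
  suffices h : ∃ f : EdgeMap (2 * k + 1),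
      (∀ e, f e = e → ∀ u ∈ (e : Sym2 (Fin (2 * k + 1))), ∀ v ∈ (e : Sym2 (Fin (2 * k + 1))),
        blockColor (k - 1) u = blockColor (k - 1) v) ∧
      ¬ ∃ S : (⊤ : SimpleGraph (Fin (2 * k + 1))).Subgraph,
        IsCopyOf S (completeGraph (Fin 3)) ∧ f.IsFree S by
    obtain ⟨f, h1, h2⟩ := h
    exact fun hff => (hff f).elim (not_exists_isFixed hk2 hT.connected h1) h2
  obtain rfl | rfl := hk
  · refine exists_not_isFree_triangle (n := 5) (q := 1) (fun u v => 3 * (u + v))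
      (by decide +kernel) ?_ ?_ <;>
    · simp only [blockColor]
      decide +kernel
  · refine exists_not_isFree_triangle (n := 9) (q := 3)
      (fun u v => Fin.ofNat 9 (3 * ((6 - u.val / 3 - v.val / 3) % 3) +
        ((6 - u.val / 3 - v.val / 3) + 6 - u.val % 3 - v.val % 3) % 3)) (by decide +kernel) ?_ ?_ <;>
    · simp only [blockColor]
      decide +kernel

lemma le_mNumber_completeGraph {r : ℕ} (hr : 1 ≤ r) (hk : 2 ≤ k) (hT : T.IsTree) :
    (((r - 1) * (k - 1) + 1 : ℕ) : ℕ∞) ≤ mNumber T (completeGraph (Fin r)) := by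
  by_cases hexc : r = 3 ∧ k = 2
  · -- The only edge mapping of `K_2` is the identity, so `(r - 1) * (k - 1) = 2` vertices do not
    -- give a counterexample here; but five do.
    obtain ⟨rfl, rfl⟩ := hexc
    refine le_trans ?_ (le_mNumber (not_fixedOrFree_completeGraph_three (Or.inl rfl) hT))
    norm_num
  refine le_mNumber fun hff => ?_
  have hblock : ∀ v : Fin ((r - 1) * (k - 1)), blockColor (k - 1) v < r - 1 := fun v =>
    (Nat.div_lt_iff_lt_mul (by omega)).2 v.isLt
  have hn : 3 ≤ (r - 1) * (k - 1) ∨ ∀ u v : Fin ((r - 1) * (k - 1)),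
      blockColor (k - 1) u = blockColor (k - 1) v := by
    by_cases h2 : r ≤ 2
    · refine Or.inr fun u v => ?_
      have h3 := hblock u
      have h4 := hblock v
      omega
    · refine Or.inl ?_
      by_cases h3 : r = 3
      · subst h3
        omega
      · exact Nat.mul_le_mul (by omega : 3 ≤ r - 1) (by omega : 1 ≤ k - 1)
  obtain ⟨f, hf⟩ := exists_fixing_blocks hn
  obtain h | ⟨S, hS, hfree⟩ := hff f
  · exact not_exists_isFixed hk hT.connected (fun e => (hf e).1) h
  · obtain ⟨φ, -, hadj⟩ := exists_vertices hS
    obtain ⟨a, b, hab, hc⟩ := Fintype.exists_ne_map_eq_of_card_lt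
      (fun a : Fin r => (⟨blockColor (k - 1) (φ a), hblock _⟩ : Fin (r - 1))) (by simp; omega)
    rw [Fin.mk.injEq] at hc
    have hab' := hadj a b hab
    refine hfree ⟨s(φ a, φ b), hab'.adj_sub⟩ hab' ?_
    rw [(hf _).2]
    · exact hab'
    · intro x hx y hy
      rw [Sym2.mem_iff] at hx hy
      rcases hx with rfl | rfl <;> rcases hy with rfl | rfl <;> simp [hc]

end LowerBounds

theorem theorem1p1 :
    -- (1) the lower bound, for every tree
    (∀ (r k : ℕ), 1 ≤ r → 2 ≤ k → ∀ T : SimpleGraph (Fin k), T.IsTree →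
      (((r - 1) * (k - 1) + 1 : ℕ) : ℕ∞) ≤ mNumber T (SimpleGraph.completeGraph (Fin r))) ∧
    -- (2a) the constant `c` depends only on `r`
    (∀ r : ℕ, 2 ≤ r → ∃ c : ℕ, ∀ k : ℕ, 2 ≤ k → ∀ T : SimpleGraph (Fin k), IsErdosSosTree T →
      mNumber T (SimpleGraph.completeGraph (Fin r)) ≤ (((r - 1) * (k - 1) + c : ℕ) : ℕ∞)) ∧
    -- (2b), (2c), (2d)
    (∀ k : ℕ, 2 ≤ k → ∀ T : SimpleGraph (Fin k), IsErdosSosTree T →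
      mNumber T (SimpleGraph.completeGraph (Fin 3)) ≤ ((2 * k + 2 : ℕ) : ℕ∞) ∧
      (¬ IsExceptionalTree T →
        mNumber T (SimpleGraph.completeGraph (Fin 3)) ≤ ((2 * k + 1 : ℕ) : ℕ∞)) ∧
      (IsExceptionalTree T →
        mNumber T (SimpleGraph.completeGraph (Fin 3)) = ((2 * k + 2 : ℕ) : ℕ∞)) ∧
      ((3 * k - 2 : ℕ) : ℕ∞) ≤ mNumber T (SimpleGraph.completeGraph (Fin 4)) ∧
      mNumber T (SimpleGraph.completeGraph (Fin 4)) ≤ ((3 * k + 33 : ℕ) : ℕ∞)) := by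
  refine ⟨fun r k hr hk T hT => le_mNumber_completeGraph hr hk hT,
    fun r hr => exists_mNumber_completeGraph_le hr, fun k hk T hT => ?_⟩
  have h3 := mNumber_le fun N hN => fixedOrFree_completeGraph_three hk hT hN
  refine ⟨h3, fun hexc => mNumber_le fun N hN => ?_, fun hexc => le_antisymm h3 ?_, ?_,
    mNumber_le fun N hN => fixedOrFree_completeGraph_four hk hT hN⟩
  · obtain rfl | hlt := hN.eq_or_lt
    · by_contra h
      exact hexc (isExceptionalTree_of_not_fixedOrFree hk hT h)
    · exact fixedOrFree_completeGraph_three hk hT hlt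
  · exact le_mNumber (not_fixedOrFree_completeGraph_three hexc.eq_two_or_four hT.1)
  · have h := le_mNumber_completeGraph (r := 4) (by norm_num) hk hT.1
    rwa [show (4 - 1) * (k - 1) + 1 = 3 * k - 2 by omega] at h
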